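/- Let $q\in(0,1)$, $a>0$, $b<0$, $\xi\in\mathbb{R}$ and $\kappa:=-\log|b/a|/\log(1/q)$. For $\varphi\in C([0,\infty);\mathbb{R})$ consider the forced pantograph equation $$z'(t)=az(qt)+bz(t)+\varphi(t),\quad t\ge 0;\qquad z(0)=\xi. \tag{1}$$ A (Lebesgue) measurable function $\gamma:[0,\infty)\to(0,\infty)$ belongs to $\mathrm{RV}_\infty(\kappa)$ if $\lim_{t\to\infty}\gamma(\lambda t)/\gamma(t)=\lambda^{\kappa}$ for every $\lambda>0$; and $f\sim g$ means $f(t)/g(t)\to1$ as $t\to\infty$. (a) For every $C>0$ and every $\gamma\in\mathrm{RV}_\infty(\kappa)$ such that $\int_1^t\gamma(s)s^{-\kappa-1}\,ds<\infty$ for all $t\ge 1$ and $t\mapsto\gamma(t)/t^{\kappa+1}$ is not in $L^1(0,\infty)$, there exists $\varphi\in C([0,\infty);\mathbb{R})$ with $\varphi(t)\sim C\gamma(t)$ such that (1) has a unique solution $z$ and, for some $D>0$, $$z(t)\sim D\,t^\kappa\int_1^t\frac{\gamma(s)}{s^{\kappa+1}}\,ds,\quad t\to\infty.$$ (b) For every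 $C>0$ and every $\gamma\in\mathrm{RV}_\infty(\kappa)$ such that $t\mapsto\gamma(t)/t^{\kappa+1}$ is in $L^1(0,\infty)$, there exists $\varphi\in C([0,\infty);\mathbb{R})$ with $\varphi(t)\sim C\gamma(t)$ such that (1) has a unique solution $z$ and, for some $D>0$, $z(t)\sim D\,t^\kappa$ as $t\to\infty$. (c) Hence the order of the upper bound $z(t)=O\bigl(t^\kappa\int_1^t\gamma(s)s^{-\kappa-1}\,ds\bigr)$ is attained: for every $C>0$ and every $\gamma\in\mathrm{RV}_\infty(\kappa)$ with $\int_1^t\gamma(s)s^{-\kappa-1}\,ds<\infty$ for all $t\ge1$, there exists $\varphi\in C([0,\infty);\mathbb{R})$ with $\varphi(t)\sim C\gamma(t)$ such that (1) has a unique solution $z$ and $$z(t)=\Theta\Bigl(t^\kappa\int_1^t\frac{\gamma(s)}{s^{\kappa+1}}\,ds\Bigr),\quad t\to\infty.$$ -/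

import Mathlib

open MeasureTheory Set Filter Asymptotics

/-- The exponent `κ = - log |b/a| / log (1/q)`, i.e. the real part of the solutions `k` of
`a q ^ k + b = 0`. -/
noncomputable def pantographExponent (a b q : ℝ) : ℝ :=
  -Real.log |b / a| / Real.log (1 / q)

/-- `γ : [0,∞) → (0,∞)` is (Lebesgue) measurable and regularly varying at infinity with index `ρ`.
Only the values of `γ` on `[0,∞)` matter. -/
structure IsRegularlyVarying (γ : ℝ → ℝ) (ρ : ℝ) : Prop where
  aemeasurable : AEMeasurable γ (volume.restrict (Ici 0))
  pos : ∀ t, 0 ≤ t → 0 < γ t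
  tendsto_ratio : ∀ l : ℝ, 0 < l → Tendsto (fun t => γ (l * t) / γ t) atTop (nhds (l ^ ρ))

/-- `z` is a solution on `[0,∞)` of the forced pantograph equation
`z'(t) = a z(q t) + b z(t) + φ(t)`, `t ≥ 0`, with `z(0) = ξ`
(the derivative at `0` is the right derivative; in particular `z` is continuous on `[0,∞)`). -/
structure IsPantographSolution (a b q : ℝ) (φ : ℝ → ℝ) (ξ : ℝ) (z : ℝ → ℝ) : Prop where
  init : z 0 = ξ
  deriv : ∀ t, 0 ≤ t → HasDerivWithinAt z (a * z (q * t) + b * z t + φ t) (Ici 0) t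

/-- `z` is a solution, and it is the only one on `[0,∞)`. -/
def IsUniquePantographSolution (a b q : ℝ) (φ : ℝ → ℝ) (ξ : ℝ) (z : ℝ → ℝ) : Prop :=
  IsPantographSolution a b q φ ξ z ∧
    ∀ w, IsPantographSolution a b q φ ξ w → EqOn w z (Ici 0)

/-- The bound `t ^ κ * ∫_1^t γ(s) / s ^ (κ + 1) ds`. -/
noncomputable def growthBound (κ : ℝ) (γ : ℝ → ℝ) (t : ℝ) : ℝ :=
  t ^ κ * ∫ s in (1 : ℝ)..t, γ s / s ^ (κ + 1)

/-! The forcing term is found by solving the inverse problem: a solution `z` of the desired growth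
is written down and `φ` is read off from the equation. Write `γ = t^κ f` with `f` slowly varying and
`L(t) = ∫_1^t f(s)/s ds`, so that the bound is `t^κ L(t)`. For `z = D t^κ F(t)`, the identity `a q^κ
= -b` gives `φ = D t^κ (κ F(t)/t + F'(t) - b (F(t) - F(qt)))`. For `φ ~ C γ`, the difference `F(t) -
F(qt)` must be asymptotic to a positive multiple of `f`, and `F/t` and `F'` must be `o(f)`.

The choice `F = L` meets the first demand, but `f` is only measurable and `L` need not be `C¹`.
Hence `F(t) = ∫_t^{2t} L(s)/s ds`, whose derivative is `g(t)/t` with `g(t) = L(2t) - L(t)`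
continuous. The uniform convergence theorem gives `g ~ f log 2`. It follows that `F ~ L log 2`, `F'
= o(f)` and `F(t) - F(qt) = ∫_{qt}^t g(s)/s ds ~ f log(1/q) log 2`; a doubling argument gives `F/t =
o(f)`.

This one construction yields (a) and (c). In (b) the integral converges, so `L` tends to a positive
constant. -/

/-! ### Slow variation and the uniform convergence theorem -/

/-- `f` is measurable and positive on `[1,∞)` and slowly varying at infinity. -/
structure IsSlowlyVarying (f : ℝ → ℝ) : Prop where
  aemeasurable : AEMeasurable f (volume.restrict (Ici 1))
  pos : ∀ t, 1 ≤ t → 0 < f t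
  tendsto_ratio : ∀ l : ℝ, 0 < l → Tendsto (fun t => f (l * t) / f t) atTop (nhds 1)

/-- The distance of the logarithms of `x` and `y`, cut off at `1`. -/
noncomputable def logDist (x y : ℝ) : ℝ := min 1 |Real.log y - Real.log x|

theorem logDist_nonneg (x y : ℝ) : 0 ≤ logDist x y := le_min zero_le_one (abs_nonneg _)

theorem logDist_le_one (x y : ℝ) : logDist x y ≤ 1 := min_le_left _ _

theorem logDist_triangle (x y w : ℝ) : logDist x y ≤ logDist x w + logDist y w := by
  unfold logDist
  have h : |Real.log y - Real.log x| ≤ |Real.log w - Real.log x| + |Real.log w - Real.log y| := by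
    have := abs_sub_le (Real.log y) (Real.log w) (Real.log x)
    rw [abs_sub_comm (Real.log y) (Real.log w)] at this
    linarith
  have h1 := abs_nonneg (Real.log w - Real.log x)
  have h2 := abs_nonneg (Real.log w - Real.log y)
  rcases min_cases 1 |Real.log w - Real.log x| with h3 | h3 <;>
  rcases min_cases 1 |Real.log w - Real.log y| with h4 | h4 <;>
  rcases min_cases 1 |Real.log y - Real.log x| with h5 | h5 <;> linarith

namespace IsSlowlyVarying

variable {f : ℝ → ℝ}

theorem aemeasurable_comp_mul (hf : IsSlowlyVarying f) {t : ℝ} (ht : 1 ≤ t) :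
    AEMeasurable (fun v => f (t * v)) (volume.restrict (Ici 1)) := by
  have hq : Measure.QuasiMeasurePreserving (fun v : ℝ => t * v) volume volume := by
    refine ⟨measurable_const_mul t, ?_⟩
    rw [Real.map_volume_mul_left (by positivity)]
    exact Measure.smul_absolutelyContinuous
  have hq' : Measure.QuasiMeasurePreserving (fun v : ℝ => t * v)
      (volume.restrict (Ici 1)) (volume.restrict (Ici 1)) := by
    refine hq.restrict fun v hv => ?_
    have hv' : (1 : ℝ) ≤ v := hv
    exact one_le_mul_of_one_le_of_one_le ht hv'
  exact hf.aemeasurable.comp_quasiMeasurePreserving hq'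

theorem aestronglyMeasurable_logDist (hf : IsSlowlyVarying f) {t : ℝ} (ht : 1 ≤ t) (x : ℝ)
    {b : ℝ} (hb : 1 ≤ b) :
    AEStronglyMeasurable (fun v => logDist x (f (t * v))) (volume.restrict (uIoc 1 b)) := by
  have h : AEMeasurable (fun v => logDist x (f (t * v))) (volume.restrict (Ici 1)) := by
    unfold logDist
    have h1 : Measurable fun y : ℝ => min 1 |Real.log y - Real.log x| := by fun_prop
    exact h1.comp_aemeasurable (hf.aemeasurable_comp_mul ht)
  refine (h.mono_measure (Measure.restrict_mono ?_ le_rfl)).aestronglyMeasurable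
  rw [uIoc_of_le hb]
  exact fun v hv => hv.1.le

theorem intervalIntegrable_logDist (hf : IsSlowlyVarying f) {t : ℝ} (ht : 1 ≤ t) (x : ℝ)
    {a b : ℝ} (ha : 1 ≤ a) (hb : 1 ≤ b) :
    IntervalIntegrable (fun v => logDist x (f (t * v))) volume a b := by
  have key : ∀ b, 1 ≤ b → IntervalIntegrable (fun v => logDist x (f (t * v))) volume 1 b := by
    intro b hb
    refine (intervalIntegrable_const (c := (1 : ℝ))).mono_fun
      (hf.aestronglyMeasurable_logDist ht x hb) (Eventually.of_forall fun v => ?_)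
    simpa [abs_of_nonneg (logDist_nonneg _ _)] using logDist_le_one _ _
  exact (key a ha).symm.trans (key b hb)

theorem tendsto_logDist (hf : IsSlowlyVarying f) {l : ℝ} (hl : 1 ≤ l) :
    Tendsto (fun t => logDist (f t) (f (t * l))) atTop (nhds 0) := by
  have h1 := ((Real.continuousAt_log one_ne_zero).tendsto.comp
    (hf.tendsto_ratio l (by positivity))).abs
  have h2 := (tendsto_const_nhds (x := (1 : ℝ))).min h1
  simp only [Real.log_one, abs_zero, zero_le_one, inf_of_le_right] at h2
  refine h2.congr' ?_
  filter_upwards [eventually_ge_atTop 1] with t ht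
  have h3 := hf.pos t ht
  have h4 := hf.pos (l * t) (one_le_mul_of_one_le_of_one_le hl ht)
  simp only [Function.comp, logDist]
  rw [Real.log_div h4.ne' h3.ne', mul_comm t l]

/-- Dominated convergence; the cutoff in `logDist` supplies the dominating constant `1`. -/
theorem tendsto_integral_logDist (hf : IsSlowlyVarying f) {b : ℝ} (hb : 1 ≤ b) :
    Tendsto (fun t => ∫ v in (1 : ℝ)..b, logDist (f t) (f (t * v))) atTop (nhds 0) := by
  have h := intervalIntegral.tendsto_integral_filter_of_dominated_convergence
    (μ := volume) (a := 1) (b := b) (l := (atTop : Filter ℝ))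
    (F := fun t v => logDist (f t) (f (t * v))) (f := fun _ => (0 : ℝ)) (fun _ => (1 : ℝ))
    ?_ ?_ intervalIntegrable_const ?_
  · simpa using h
  · filter_upwards [eventually_ge_atTop 1] with t ht
    exact hf.aestronglyMeasurable_logDist ht (f t) hb
  · refine Eventually.of_forall fun t => Eventually.of_forall fun v _ => ?_
    rw [Real.norm_of_nonneg (logDist_nonneg _ _)]
    exact logDist_le_one _ _
  · refine Eventually.of_forall fun v hv => ?_
    rw [uIoc_of_le hb] at hv
    exact hf.tendsto_logDist hv.1.le

/-- The triangle inequality through `f (t * v)` is integrated over `v ∈ [Λ, Λ²]`. In the second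
integral, `v = u w` puts `w` in `[Λ/u, Λ²/u] ⊆ [1, Λ²]`, at the cost of a factor `u ≤ Λ`. Both
integrals are then values of one function of the base point that tends to `0`, which makes the bound
uniform in `u`. -/
theorem logDist_le_integral (hf : IsSlowlyVarying f) {Λ t u : ℝ} (hΛ : 1 < Λ) (ht : 1 ≤ t)
    (hu : u ∈ Icc 1 Λ) :
    (Λ ^ 2 - Λ) * logDist (f t) (f (u * t)) ≤
      (∫ v in (1 : ℝ)..Λ ^ 2, logDist (f t) (f (t * v))) +
        Λ * ∫ v in (1 : ℝ)..Λ ^ 2, logDist (f (u * t)) (f (u * t * v)) := by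
  have hu0 : 0 < u := by linarith [hu.1]
  have hΛ2 : Λ ≤ Λ ^ 2 := by nlinarith
  have hut : 1 ≤ u * t := one_le_mul_of_one_le_of_one_le hu.1 ht
  have hi1 := hf.intervalIntegrable_logDist ht (f t) hΛ.le (hΛ.le.trans hΛ2)
  have hi2 := hf.intervalIntegrable_logDist ht (f (u * t)) hΛ.le (hΛ.le.trans hΛ2)
  have h1 : (Λ ^ 2 - Λ) * logDist (f t) (f (u * t)) ≤
      (∫ v in Λ..Λ ^ 2, logDist (f t) (f (t * v))) +
        ∫ v in Λ..Λ ^ 2, logDist (f (u * t)) (f (t * v)) := by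
    rw [← intervalIntegral.integral_add hi1 hi2, ← smul_eq_mul, ← intervalIntegral.integral_const]
    exact intervalIntegral.integral_mono_on hΛ2 intervalIntegrable_const (hi1.add hi2)
      fun v _ => logDist_triangle _ _ _
  have h2 : (∫ v in Λ..Λ ^ 2, logDist (f t) (f (t * v))) ≤
      ∫ v in (1 : ℝ)..Λ ^ 2, logDist (f t) (f (t * v)) :=
    intervalIntegral.integral_mono_interval hΛ.le hΛ2 le_rfl
      (Eventually.of_forall fun v => logDist_nonneg _ _)
      (hf.intervalIntegrable_logDist ht (f t) le_rfl (hΛ.le.trans hΛ2))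
  have h3 : (∫ v in Λ..Λ ^ 2, logDist (f (u * t)) (f (t * v))) =
      u * ∫ v in Λ / u..Λ ^ 2 / u, logDist (f (u * t)) (f (u * t * v)) := by
    have := intervalIntegral.mul_integral_comp_mul_left (a := Λ / u) (b := Λ ^ 2 / u)
      (f := fun v => logDist (f (u * t)) (f (t * v))) u
    rw [mul_div_cancel₀ _ hu0.ne', mul_div_cancel₀ _ hu0.ne'] at this
    rw [← this]
    congr 2 with v
    ring_nf
  have h4 : (∫ v in Λ / u..Λ ^ 2 / u, logDist (f (u * t)) (f (u * t * v))) ≤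
      ∫ v in (1 : ℝ)..Λ ^ 2, logDist (f (u * t)) (f (u * t * v)) :=
    intervalIntegral.integral_mono_interval ((one_le_div hu0).2 hu.2)
      (div_le_div_of_nonneg_right hΛ2 hu0.le) (div_le_self (by positivity) hu.1)
      (Eventually.of_forall fun v => logDist_nonneg _ _)
      (hf.intervalIntegrable_logDist hut (f (u * t)) le_rfl (hΛ.le.trans hΛ2))
  have h5 : 0 ≤ ∫ v in (1 : ℝ)..Λ ^ 2, logDist (f (u * t)) (f (u * t * v)) :=
    intervalIntegral.integral_nonneg (hΛ.le.trans hΛ2) fun v _ => logDist_nonneg _ _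
  have h6 := mul_le_mul_of_nonneg_left h4 hu0.le
  have h7 := mul_le_mul_of_nonneg_right hu.2 h5
  linarith

/-- The uniform convergence theorem for slowly varying functions. -/
theorem eventually_abs_sub_le (hf : IsSlowlyVarying f) {Λ ε : ℝ} (hΛ : 1 < Λ) (hε : 0 < ε) :
    ∀ᶠ t in atTop, ∀ s ∈ Icc t (Λ * t), |f s - f t| ≤ ε * f t := by
  have hexp : Tendsto (fun x => |Real.exp x - 1|) (nhds 0) (nhds 0) := by
    have : Continuous fun x => |Real.exp x - 1| := by fun_prop
    simpa using this.tendsto 0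
  obtain ⟨δ, hδ, hδε⟩ := Metric.eventually_nhds_iff.1 (hexp.eventually (gt_mem_nhds hε))
  -- Below `1` the cutoff in `logDist` is inactive, so `logDist < m` bounds the true difference of
  -- logarithms by `δ`.
  set m := min 1 δ with hm
  have hm0 : 0 < m := lt_min one_pos hδ
  have hc : 0 < Λ ^ 2 - Λ := by nlinarith
  have hη : 0 < (Λ ^ 2 - Λ) * m / (2 * Λ + 2) := by positivity
  have hΛ2 : 1 ≤ Λ ^ 2 := by nlinarith
  obtain ⟨T, hT⟩ := eventually_atTop.1
    ((hf.tendsto_integral_logDist hΛ2).eventually (gt_mem_nhds hη))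
  filter_upwards [eventually_ge_atTop 1, eventually_ge_atTop T] with t ht1 htT s hs
  have ht0 : 0 < t := by linarith
  have hu : s / t ∈ Icc 1 Λ := ⟨(one_le_div ht0).2 hs.1, (div_le_iff₀ ht0).2 hs.2⟩
  have hst : s / t * t = s := div_mul_cancel₀ _ ht0.ne'
  have h := hf.logDist_le_integral hΛ ht1 hu
  rw [hst] at h
  have h1 := hT t htT
  have h2 := hT s (htT.trans hs.1)
  have hη2 : (Λ ^ 2 - Λ) * m / (2 * Λ + 2) * (2 * Λ + 2) = (Λ ^ 2 - Λ) * m :=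
    div_mul_cancel₀ _ (by positivity)
  have h3 : (Λ ^ 2 - Λ) * logDist (f t) (f s) < (Λ ^ 2 - Λ) * m := by nlinarith
  have h4 : logDist (f t) (f s) < m := lt_of_mul_lt_mul_left h3 hc.le
  have hft := hf.pos t ht1
  have hfs := hf.pos s (ht1.trans hs.1)
  have h5 : |Real.log (f s) - Real.log (f t)| < δ := by
    rcases min_lt_iff.1 h4 with h6 | h6
    · exact absurd (h6.trans_le (min_le_left _ _)) (lt_irrefl _)
    · exact h6.trans_le (min_le_right _ _)
  have h6 := hδε (y := Real.log (f s) - Real.log (f t)) (by simpa [Real.dist_eq] using h5)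
  rw [Real.exp_sub, Real.exp_log hfs, Real.exp_log hft, div_sub_one hft.ne', abs_div,
    abs_of_pos hft, div_lt_iff₀ hft] at h6
  exact h6.le

/-! ### Integrals of slowly varying functions over multiplicative windows -/

/-- `∫_t^{Λt} f(s)/s ds ~ f(t) log Λ` for slowly varying `f`. -/
theorem tendsto_integral_div (hf : IsSlowlyVarying f) {Λ : ℝ} (hΛ : 1 < Λ)
    (hint : ∀ t : ℝ, 1 ≤ t → IntervalIntegrable (fun s => f s / s) volume 1 t) :
    Tendsto (fun t => (∫ s in t..Λ * t, f s / s) / f t) atTop (nhds (Real.log Λ)) := by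
  have hlog : 0 < Real.log Λ := Real.log_pos hΛ
  rw [Metric.tendsto_nhds]
  intro ε hε
  have hε' : 0 < ε / 2 / Real.log Λ := by positivity
  filter_upwards [hf.eventually_abs_sub_le hΛ hε', eventually_ge_atTop 1] with t ht ht1
  have ht0 : 0 < t := by linarith
  have hft := hf.pos t ht1
  have htΛ : t ≤ Λ * t := le_mul_of_one_le_left ht0.le hΛ.le
  have hi : IntervalIntegrable (fun s => f s / s) volume t (Λ * t) :=
    (hint t ht1).symm.trans (hint _ (ht1.trans htΛ))
  have hinv : IntervalIntegrable (fun s : ℝ => s⁻¹) volume t (Λ * t) := by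
    refine intervalIntegral.intervalIntegrable_inv (fun s hs => ?_) continuousOn_id
    rw [uIcc_of_le htΛ] at hs
    exact (ht0.trans_le hs.1).ne'
  have hlogi : (∫ s in t..Λ * t, s⁻¹) = Real.log Λ := by
    rw [integral_inv_of_pos ht0 (ht0.trans_le htΛ), mul_div_assoc, div_self ht0.ne', mul_one]
  have h1 : (∫ s in t..Λ * t, f s / s) - f t * Real.log Λ =
      ∫ s in t..Λ * t, (f s / s - f t * s⁻¹) := by
    rw [intervalIntegral.integral_sub hi (hinv.const_mul _), intervalIntegral.integral_const_mul,
      hlogi]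
  have h2 : ‖∫ s in t..Λ * t, (f s / s - f t * s⁻¹)‖ ≤
      ∫ s in t..Λ * t, (ε / 2 / Real.log Λ * f t) * s⁻¹ := by
    refine intervalIntegral.norm_integral_le_of_norm_le htΛ
      (Eventually.of_forall fun s hs => ?_) (hinv.const_mul _)
    have hs0 : 0 < s := ht0.trans hs.1
    rw [div_eq_mul_inv, ← sub_mul, norm_mul, Real.norm_eq_abs, norm_inv,
      Real.norm_of_nonneg hs0.le]
    exact mul_le_mul_of_nonneg_right (ht s ⟨hs.1.le, hs.2⟩) (inv_nonneg.2 hs0.le)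
  rw [intervalIntegral.integral_const_mul, hlogi, ← h1, Real.norm_eq_abs] at h2
  have h3 : ε / 2 / Real.log Λ * f t * Real.log Λ = ε / 2 * f t := by field_simp
  rw [h3] at h2
  rw [Real.dist_eq, div_sub' hft.ne', abs_div, abs_of_pos hft, div_lt_iff₀ hft]
  nlinarith

/-- `∫_{rt}^t f(s)/s ds ~ f(t) log (1/r)` for slowly varying `f`. -/
theorem tendsto_integral_div_of_lt_one (hf : IsSlowlyVarying f) {r : ℝ} (hr0 : 0 < r) (hr : r < 1)
    (hint : ∀ t : ℝ, 1 ≤ t → IntervalIntegrable (fun s => f s / s) volume 1 t) :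
    Tendsto (fun t => (∫ s in r * t..t, f s / s) / f t) atTop (nhds (Real.log (1 / r))) := by
  -- The window `[rt, t]` is `[x, Λx]` with `x = rt` and `Λ = 1/r`; the ratio `f (r * t) / f t → 1`
  -- then restores the denominator `f t`.
  have h1 := (hf.tendsto_integral_div (one_lt_one_div hr0 hr) hint).comp
    (tendsto_id.const_mul_atTop hr0)
  have h2 := h1.mul (hf.tendsto_ratio r hr0)
  rw [mul_one] at h2
  refine h2.congr' ?_
  filter_upwards [eventually_ge_atTop (1 / r)] with t ht
  have h3 := hf.pos (r * t) (by rwa [div_le_iff₀' hr0] at ht)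
  simp only [Function.comp, id]
  rw [← mul_assoc, one_div_mul_cancel hr0.ne', one_mul, div_mul_div_cancel₀ h3.ne']

/-- A positive continuous function asymptotic to a multiple of a slowly varying one is slowly
varying. -/
theorem of_tendsto_div (hf : IsSlowlyVarying f) {g : ℝ → ℝ} (hg : Continuous g)
    (hpos : ∀ t, 1 ≤ t → 0 < g t) {c : ℝ} (hc : c ≠ 0)
    (h : Tendsto (fun t => g t / f t) atTop (nhds c)) : IsSlowlyVarying g where
  aemeasurable := hg.aemeasurable
  pos := hpos
  tendsto_ratio l hl := by
    have h1 := ((h.comp (tendsto_id.const_mul_atTop hl)).div h hc).mul (hf.tendsto_ratio l hl)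
    rw [div_self hc, mul_one] at h1
    refine h1.congr' ?_
    filter_upwards [eventually_ge_atTop (1 / l), eventually_ge_atTop 1] with t htl ht
    have h3 := hf.pos (l * t) (by rwa [div_le_iff₀' hl] at htl)
    have h4 := hf.pos t ht
    have h5 := hpos t ht
    simp only [Function.comp, id, Pi.div_apply]
    field_simp

end IsSlowlyVarying

/-! ### Decay under doubling -/

/-- A nonnegative continuous function that shrinks by a fixed factor under doubling of the argument
tends to `0`. -/
theorem tendsto_zero_of_two_mul_le {ρ : ℝ → ℝ} {T c : ℝ} (hT : 0 < T) (hc0 : 0 ≤ c) (hc1 : c < 1)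
    (hρ : ContinuousOn ρ (Ici T)) (hpos : ∀ t, T ≤ t → 0 ≤ ρ t)
    (h : ∀ t, T ≤ t → ρ (2 * t) ≤ c * ρ t) : Tendsto ρ atTop (nhds 0) := by
  -- Repeated halving brings every `t ≥ T` into `[T, 2T]`, where compactness bounds `ρ`. Each
  -- halving costs a factor `c`.
  obtain ⟨M, hM⟩ := (isCompact_Icc (a := T) (b := 2 * T)).bddAbove_image
    (hρ.mono Icc_subset_Ici_self)
  have hM0 : ∀ t ∈ Icc T (2 * T), ρ t ≤ M := fun t ht => hM (mem_image_of_mem _ ht)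
  have hhalf : ∀ t, 2 * T ≤ t → ρ t ≤ c * ρ (t / 2) := by
    intro t ht
    have := h (t / 2) (by linarith)
    rwa [mul_div_cancel₀ _ two_ne_zero] at this
  have hbase : ∀ n : ℕ, ∀ t, T ≤ t → t ≤ 2 ^ n * T → ρ t ≤ M := by
    intro n
    induction n with
    | zero =>
      intro t h1 h2
      exact hM0 t ⟨h1, by simp at h2; linarith⟩
    | succ n ih =>
      intro t h1 h2
      rcases le_total t (2 * T) with h3 | h3
      · exact hM0 t ⟨h1, h3⟩
      · have h4 := ih (t / 2) (by linarith) (by rw [pow_succ] at h2; linarith)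
        have h5 := hpos (t / 2) (by linarith)
        have h6 := hhalf t h3
        nlinarith
  have hbound : ∀ t, T ≤ t → ρ t ≤ M := by
    intro t ht
    obtain ⟨n, hn⟩ := pow_unbounded_of_one_lt (t / T) one_lt_two
    exact hbase n t ht ((div_lt_iff₀ hT).1 hn).le
  have hdecay : ∀ n : ℕ, ∀ t, 2 ^ n * T ≤ t → ρ t ≤ c ^ n * M := by
    intro n
    induction n with
    | zero => intro t ht; simpa using hbound t (by simpa using ht)
    | succ n ih =>
      intro t ht
      have h2 : (1 : ℝ) ≤ 2 ^ n := one_le_pow₀ one_le_two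
      have h1 := ih (t / 2) (by rw [pow_succ] at ht; linarith)
      have h3 := hhalf t (by rw [pow_succ] at ht; nlinarith)
      calc ρ t ≤ c * (c ^ n * M) := h3.trans (mul_le_mul_of_nonneg_left h1 hc0)
        _ = c ^ (n + 1) * M := by ring
  have hlim : Tendsto (fun n : ℕ => c ^ n * M) atTop (nhds 0) := by
    simpa using (tendsto_pow_atTop_nhds_zero_of_lt_one hc0 hc1).mul_const M
  rw [Metric.tendsto_nhds]
  intro ε hε
  obtain ⟨n, hn⟩ := (hlim.eventually (gt_mem_nhds hε)).exists
  filter_upwards [eventually_ge_atTop (2 ^ n * T), eventually_ge_atTop T] with t ht htT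
  rw [dist_zero_right, Real.norm_of_nonneg (hpos t htT)]
  exact (hdecay n t ht).trans_lt hn

/-! ### The primitive `L` and its `C¹` smoothing `F` -/

/-- `∫_1^t f(s)/s ds`. -/
noncomputable def logPrimitive (f : ℝ → ℝ) (t : ℝ) : ℝ := ∫ s in (1 : ℝ)..t, f s / s

/-- `∫_t^{2t} f(s)/s ds`. -/
noncomputable def logIncrement (f : ℝ → ℝ) (t : ℝ) : ℝ := logPrimitive f (2 * t) - logPrimitive f t

/-- A continuously differentiable function that equals `∫_t^{2t} L(s)/s ds` on `[1,∞)`, where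
`L = logPrimitive f`. -/
noncomputable def smoothPrimitive (f : ℝ → ℝ) (t : ℝ) : ℝ :=
  (∫ s in (1 : ℝ)..2, logPrimitive f s / s) + ∫ s in (1 : ℝ)..t, logIncrement f s / max s 1

theorem logPrimitive_sub {f : ℝ → ℝ} (hint : ∀ a b, IntervalIntegrable (fun s => f s / s) volume a b)
    (a b : ℝ) : logPrimitive f b - logPrimitive f a = ∫ s in a..b, f s / s :=
  intervalIntegral.integral_interval_sub_left (hint _ _) (hint _ _)

theorem continuous_logPrimitive {f : ℝ → ℝ}
    (hint : ∀ a b, IntervalIntegrable (fun s => f s / s) volume a b) :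
    Continuous (logPrimitive f) :=
  intervalIntegral.continuous_primitive hint 1

theorem continuous_logIncrement {f : ℝ → ℝ}
    (hint : ∀ a b, IntervalIntegrable (fun s => f s / s) volume a b) :
    Continuous (logIncrement f) := by
  have := continuous_logPrimitive hint
  unfold logIncrement
  fun_prop

theorem continuous_div_max {g : ℝ → ℝ} (hg : Continuous g) : Continuous fun s => g s / max s 1 :=
  hg.div (by fun_prop) fun s => (zero_lt_one.trans_le (le_max_right s 1)).ne'

theorem intervalIntegrable_div_of_continuous {g : ℝ → ℝ} (hg : Continuous g) {a b : ℝ}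
    (ha : 0 < a) (hb : 0 < b) : IntervalIntegrable (fun s => g s / s) volume a b := by
  refine ContinuousOn.intervalIntegrable (hg.continuousOn.div continuousOn_id fun s hs => ?_)
  exact ((lt_min ha hb).trans_le hs.1).ne'

theorem hasDerivAt_smoothPrimitive {f : ℝ → ℝ}
    (hint : ∀ a b, IntervalIntegrable (fun s => f s / s) volume a b) (t : ℝ) :
    HasDerivAt (smoothPrimitive f) (logIncrement f t / max t 1) t :=
  ((continuous_div_max (continuous_logIncrement hint)).integral_hasStrictDerivAt 1
    t).hasDerivAt.const_add _

theorem smoothPrimitive_eq_add {f : ℝ → ℝ} {t : ℝ} (ht : 1 ≤ t) :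
    smoothPrimitive f t =
      (∫ s in (1 : ℝ)..2, logPrimitive f s / s) + ∫ s in (1 : ℝ)..t, logIncrement f s / s := by
  unfold smoothPrimitive
  congr 1
  refine intervalIntegral.integral_congr fun s hs => ?_
  rw [uIcc_of_le ht] at hs
  simp only [max_eq_left hs.1]

theorem smoothPrimitive_sub {f : ℝ → ℝ}
    (hint : ∀ a b, IntervalIntegrable (fun s => f s / s) volume a b) {a b : ℝ}
    (ha : 1 ≤ a) (hb : 1 ≤ b) :
    smoothPrimitive f b - smoothPrimitive f a = ∫ s in a..b, logIncrement f s / s := by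
  have hg := continuous_logIncrement hint
  rw [smoothPrimitive_eq_add ha, smoothPrimitive_eq_add hb, add_sub_add_left_eq_sub]
  exact intervalIntegral.integral_interval_sub_left
    (intervalIntegrable_div_of_continuous hg one_pos (by linarith))
    (intervalIntegrable_div_of_continuous hg one_pos (by linarith))

/-- Since `g(s) = L(2s) - L(s)`, the substitution `s ↦ 2s` gives `∫_1^t g/s = ∫_2^{2t} L/s - ∫_1^t
L/s`. The constant `∫_1^2 L/s` in the definition closes the gap. -/
theorem smoothPrimitive_eq {f : ℝ → ℝ}
    (hint : ∀ a b, IntervalIntegrable (fun s => f s / s) volume a b) {t : ℝ} (ht : 1 ≤ t) :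
    smoothPrimitive f t = ∫ s in t..2 * t, logPrimitive f s / s := by
  have hL := continuous_logPrimitive hint
  have hL2 : Continuous fun s => logPrimitive f (2 * s) := by fun_prop
  have hi : ∀ {a b : ℝ}, 0 < a → 0 < b →
      IntervalIntegrable (fun s => logPrimitive f s / s) volume a b :=
    fun ha hb => intervalIntegrable_div_of_continuous hL ha hb
  have ht0 : 0 < t := by linarith
  have h1 : (∫ s in (1 : ℝ)..t, logIncrement f s / s) =
      (∫ s in (1 : ℝ)..t, logPrimitive f (2 * s) / s) - ∫ s in (1 : ℝ)..t, logPrimitive f s / s := by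
    rw [← intervalIntegral.integral_sub (intervalIntegrable_div_of_continuous hL2 one_pos ht0)
      (hi one_pos ht0)]
    simp only [logIncrement, sub_div]
  have h2 : (∫ s in (1 : ℝ)..t, logPrimitive f (2 * s) / s) =
      ∫ s in (2 : ℝ)..2 * t, logPrimitive f s / s := by
    have h := intervalIntegral.mul_integral_comp_mul_left (a := 1) (b := t)
      (f := fun s => logPrimitive f s / s) 2
    rw [mul_one] at h
    rw [← h, ← intervalIntegral.integral_const_mul]
    refine intervalIntegral.integral_congr fun s _ => ?_
    rw [← mul_div_assoc, mul_div_mul_left _ _ two_ne_zero]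
  have h3 := intervalIntegral.integral_add_adjacent_intervals (hi one_pos two_pos)
    (hi two_pos (by linarith : 0 < 2 * t))
  have h4 := intervalIntegral.integral_add_adjacent_intervals (hi one_pos ht0)
    (hi ht0 (by linarith : 0 < 2 * t))
  rw [smoothPrimitive_eq_add ht, h1, h2]
  linarith

/-! ### Asymptotics of `L`, `g` and `F` relative to `f` -/

namespace IsSlowlyVarying

variable {f : ℝ → ℝ}

theorem logPrimitive_mono (hf : IsSlowlyVarying f)
    (hint : ∀ a b, IntervalIntegrable (fun s => f s / s) volume a b) {a b : ℝ} (ha : 1 ≤ a)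
    (hab : a ≤ b) : logPrimitive f a ≤ logPrimitive f b := by
  rw [← sub_nonneg, logPrimitive_sub hint]
  refine intervalIntegral.integral_nonneg hab fun s hs => ?_
  have h1 : 1 ≤ s := ha.trans hs.1
  exact div_nonneg (hf.pos s h1).le (by linarith)

theorem logPrimitive_lt (hf : IsSlowlyVarying f)
    (hint : ∀ a b, IntervalIntegrable (fun s => f s / s) volume a b) {a b : ℝ} (ha : 1 ≤ a)
    (hab : a < b) : logPrimitive f a < logPrimitive f b := by
  rw [← sub_pos, logPrimitive_sub hint]
  refine intervalIntegral.intervalIntegral_pos_of_pos_on (hint _ _) (fun s hs => ?_) hab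
  have h1 : 1 ≤ s := ha.trans hs.1.le
  exact div_pos (hf.pos s h1) (by linarith)

theorem logPrimitive_pos (hf : IsSlowlyVarying f)
    (hint : ∀ a b, IntervalIntegrable (fun s => f s / s) volume a b) {t : ℝ} (ht : 1 < t) :
    0 < logPrimitive f t := by
  have := hf.logPrimitive_lt hint le_rfl ht
  simpa [logPrimitive] using this

theorem logIncrement_pos (hf : IsSlowlyVarying f)
    (hint : ∀ a b, IntervalIntegrable (fun s => f s / s) volume a b) {t : ℝ} (ht : 1 ≤ t) :
    0 < logIncrement f t :=
  sub_pos.2 (hf.logPrimitive_lt hint ht (by linarith))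

/-- Already the part of `L(t)` over `[rt, t]` is asymptotic to `f(t) log(1/r)`, and `r` may be taken
arbitrarily small. -/
theorem tendsto_div_logPrimitive (hf : IsSlowlyVarying f)
    (hint : ∀ a b, IntervalIntegrable (fun s => f s / s) volume a b) :
    Tendsto (fun t => f t / logPrimitive f t) atTop (nhds 0) := by
  have h : Tendsto (fun t => logPrimitive f t / f t) atTop atTop := by
    refine tendsto_atTop.2 fun M => ?_
    set r := Real.exp (-(|M| + 1)) with hr
    have hr0 : 0 < r := Real.exp_pos _
    have hr1 : r < 1 := by
      rw [hr, Real.exp_lt_one_iff]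
      linarith [abs_nonneg M]
    have hlim := hf.tendsto_integral_div_of_lt_one hr0 hr1 fun t _ => hint 1 t
    have hlog : M < Real.log (1 / r) := by
      rw [one_div, Real.log_inv, hr, Real.log_exp]
      linarith [le_abs_self M]
    filter_upwards [hlim.eventually (lt_mem_nhds hlog), eventually_ge_atTop (1 / r),
      eventually_ge_atTop 1] with t h1 h2 h3
    refine h1.le.trans (div_le_div_of_nonneg_right ?_ (hf.pos t h3).le)
    rw [← logPrimitive_sub hint]
    have h4 : 1 ≤ r * t := by rwa [div_le_iff₀' hr0] at h2
    have h5 := hf.logPrimitive_mono hint le_rfl h4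
    have h6 : logPrimitive f 1 = 0 := by simp [logPrimitive]
    linarith
  refine h.inv_tendsto_atTop.congr fun t => ?_
  simp

theorem tendsto_logIncrement_div (hf : IsSlowlyVarying f)
    (hint : ∀ a b, IntervalIntegrable (fun s => f s / s) volume a b) :
    Tendsto (fun t => logIncrement f t / f t) atTop (nhds (Real.log 2)) := by
  simpa only [logIncrement, logPrimitive_sub hint] using
    hf.tendsto_integral_div one_lt_two fun t _ => hint 1 t

theorem tendsto_logPrimitive_two_mul_div (hf : IsSlowlyVarying f)
    (hint : ∀ a b, IntervalIntegrable (fun s => f s / s) volume a b) :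
    Tendsto (fun t => logPrimitive f (2 * t) / logPrimitive f t) atTop (nhds 1) := by
  have h := ((hf.tendsto_logIncrement_div hint).mul (hf.tendsto_div_logPrimitive hint)).const_add 1
  rw [mul_zero, add_zero] at h
  refine h.congr' ?_
  filter_upwards [eventually_gt_atTop 1] with t ht
  have h1 := hf.pos t ht.le
  have h2 := hf.logPrimitive_pos hint ht
  rw [div_mul_div_cancel₀ h1.ne', logIncrement]
  field_simp
  ring

/-- This allows the merely measurable `f` to be replaced by the continuous `g`, to which the window
integrals and the doubling argument are then applied. -/
theorem isSlowlyVarying_logIncrement (hf : IsSlowlyVarying f)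
    (hint : ∀ a b, IntervalIntegrable (fun s => f s / s) volume a b) :
    IsSlowlyVarying (logIncrement f) :=
  hf.of_tendsto_div (continuous_logIncrement hint) (fun _ ht => hf.logIncrement_pos hint ht)
    (Real.log_pos one_lt_two).ne' (hf.tendsto_logIncrement_div hint)

/-- Doubling turns `L` into `L + g` and eventually multiplies `t g` by at least `4/3`. So the
quotient shrinks by the factor `3/4`, up to an error `3/(4t)`. -/
theorem tendsto_logPrimitive_div_mul (hf : IsSlowlyVarying f)
    (hint : ∀ a b, IntervalIntegrable (fun s => f s / s) volume a b) :
    Tendsto (fun t => logPrimitive f t / (t * logIncrement f t)) atTop (nhds 0) := by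
  set g := logIncrement f with hg
  have hgpos : ∀ t, 1 ≤ t → 0 < g t := fun t ht => hf.logIncrement_pos hint ht
  have hgc : Continuous g := continuous_logIncrement hint
  have hLc := continuous_logPrimitive hint
  have hratio := ((hf.isSlowlyVarying_logIncrement hint).tendsto_ratio 2 two_pos).eventually
    (lt_mem_nhds (by norm_num : (2 / 3 : ℝ) < 1))
  obtain ⟨T, hT⟩ := eventually_atTop.1 (hratio.and (eventually_gt_atTop 1))
  have hT1 := (hT T le_rfl).2
  have hLpos : ∀ t, T ≤ t → 0 < logPrimitive f t := fun t ht =>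
    hf.logPrimitive_pos hint (hT1.trans_le ht)
  -- The summand `3/t` absorbs the error, since `3/(4t) + 3/(2t) = (3/4)(3/t)`.
  have h : Tendsto (fun t => logPrimitive f t / (t * g t) + 3 / t) atTop (nhds 0) := by
    refine tendsto_zero_of_two_mul_le (T := T) (c := 3 / 4) (by linarith) (by norm_num)
      (by norm_num) ?_ ?_ ?_
    · have hne : ∀ t ∈ Ici T, t * g t ≠ 0 := fun t ht =>
        (mul_pos (by linarith [mem_Ici.1 ht]) (hgpos t (hT1.le.trans ht))).ne'
      refine (hLc.continuousOn.div (by fun_prop) hne).add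
        (continuousOn_const.div continuousOn_id fun t ht => ?_)
      exact left_ne_zero_of_mul (hne t ht)
    · intro t ht
      have h1 := hLpos t ht
      have h2 := hgpos t (hT1.le.trans ht)
      have h3 : 0 < t := by linarith
      positivity
    · intro t ht
      have h1 := hLpos t ht
      have h2 := hgpos t (hT1.le.trans ht)
      have h3 : 0 < t := by linarith
      have h4 := hgpos (2 * t) (by linarith)
      have h5 := (hT t ht).1
      rw [lt_div_iff₀ h2] at h5
      have h6 : logPrimitive f (2 * t) = logPrimitive f t + g t := by
        rw [hg, logIncrement]; ring
      have h7 : logPrimitive f (2 * t) / (2 * t * g (2 * t)) ≤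
          (logPrimitive f t + g t) / (2 * t * (2 / 3 * g t)) := by
        rw [h6]
        gcongr
      have h8 : (logPrimitive f t + g t) / (2 * t * (2 / 3 * g t)) =
          3 / 4 * (logPrimitive f t / (t * g t)) + 3 / 4 / t := by
        field_simp
        ring
      have h9 : (3 : ℝ) / (2 * t) = 3 / 2 / t := by field_simp
      have h10 : 3 / 4 * (logPrimitive f t / (t * g t) + 3 / t) =
          3 / 4 * (logPrimitive f t / (t * g t)) + 3 / 4 / t + 3 / 2 / t := by
        field_simp
        ring
      rw [h10, h9]
      linarith
  have h3 : Tendsto (fun t : ℝ => 3 / t) atTop (nhds 0) := tendsto_const_nhds.div_atTop tendsto_id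
  simpa using h.sub h3

/-- Monotonicity of `L` squeezes `F(t)` between `L(t) log 2` and `L(2t) log 2`, and `L(2t) ~ L(t)`.
-/
theorem tendsto_smoothPrimitive_div_logPrimitive (hf : IsSlowlyVarying f)
    (hint : ∀ a b, IntervalIntegrable (fun s => f s / s) volume a b) :
    Tendsto (fun t => smoothPrimitive f t / logPrimitive f t) atTop (nhds (Real.log 2)) := by
  have hup := (hf.tendsto_logPrimitive_two_mul_div hint).mul_const (Real.log 2)
  rw [one_mul] at hup
  have hL := continuous_logPrimitive hint
  have hinv : ∀ t : ℝ, 1 < t → IntervalIntegrable (fun s : ℝ => s⁻¹) volume t (2 * t) := by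
    intro t ht
    simpa only [one_div] using intervalIntegrable_div_of_continuous (g := fun _ => 1)
      continuous_const (by linarith) (by linarith)
  have hlog : ∀ t : ℝ, 1 < t → (∫ s in t..2 * t, s⁻¹) = Real.log 2 := by
    intro t ht
    rw [integral_inv_of_pos (by linarith) (by linarith), mul_div_assoc,
      div_self (by linarith), mul_one]
  refine tendsto_of_tendsto_of_tendsto_of_le_of_le' tendsto_const_nhds hup ?_ ?_ <;>
  filter_upwards [eventually_gt_atTop 1] with t ht
  · have h1 := hf.logPrimitive_pos hint ht
    rw [le_div_iff₀ h1, smoothPrimitive_eq hint ht.le, ← hlog t ht, mul_comm,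
      ← intervalIntegral.integral_const_mul]
    refine intervalIntegral.integral_mono_on (by linarith) ((hinv t ht).const_mul _)
      (intervalIntegrable_div_of_continuous hL (by linarith) (by linarith)) fun s hs => ?_
    rw [← div_eq_mul_inv]
    exact div_le_div_of_nonneg_right (hf.logPrimitive_mono hint ht.le hs.1) (by linarith [hs.1])
  · have h1 := hf.logPrimitive_pos hint ht
    rw [div_mul_eq_mul_div]
    refine div_le_div_of_nonneg_right ?_ h1.le
    rw [smoothPrimitive_eq hint ht.le, ← hlog t ht, ← intervalIntegral.integral_const_mul]
    refine intervalIntegral.integral_mono_on (by linarith)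
      (intervalIntegrable_div_of_continuous hL (by linarith) (by linarith))
      ((hinv t ht).const_mul _) fun s hs => ?_
    rw [← div_eq_mul_inv]
    exact div_le_div_of_nonneg_right
      (hf.logPrimitive_mono hint (ht.le.trans hs.1) hs.2) (by linarith [hs.1])

/-- The main term of the forcing: the difference is `∫_{qt}^t g(s)/s ds ~ g(t) log(1/q)`, and `g ~ f
log 2`. -/
theorem tendsto_smoothPrimitive_sub_div (hf : IsSlowlyVarying f)
    (hint : ∀ a b, IntervalIntegrable (fun s => f s / s) volume a b) {q : ℝ} (hq0 : 0 < q)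
    (hq1 : q < 1) :
    Tendsto (fun t => (smoothPrimitive f t - smoothPrimitive f (q * t)) / f t) atTop
      (nhds (Real.log (1 / q) * Real.log 2)) := by
  have h := ((hf.isSlowlyVarying_logIncrement hint).tendsto_integral_div_of_lt_one hq0 hq1 fun t ht =>
    intervalIntegrable_div_of_continuous (continuous_logIncrement hint) one_pos
      (by linarith)).mul (hf.tendsto_logIncrement_div hint)
  refine h.congr' ?_
  filter_upwards [eventually_ge_atTop 1, eventually_ge_atTop (1 / q)] with t ht htq
  rw [div_le_iff₀' hq0] at htq
  rw [div_mul_div_cancel₀ (hf.logIncrement_pos hint ht).ne', smoothPrimitive_sub hint htq ht]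

theorem tendsto_smoothPrimitive_div_mul (hf : IsSlowlyVarying f)
    (hint : ∀ a b, IntervalIntegrable (fun s => f s / s) volume a b) :
    Tendsto (fun t => smoothPrimitive f t / (t * f t)) atTop (nhds 0) := by
  have h := ((hf.tendsto_smoothPrimitive_div_logPrimitive hint).mul
    (hf.tendsto_logPrimitive_div_mul hint)).mul (hf.tendsto_logIncrement_div hint)
  rw [mul_zero, zero_mul] at h
  refine h.congr' ?_
  filter_upwards [eventually_gt_atTop 1] with t ht
  have h1 := hf.logPrimitive_pos hint ht
  have h2 := hf.logIncrement_pos hint ht.le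
  have h3 := hf.pos t ht.le
  have h4 : 0 < t := by linarith
  field_simp

theorem tendsto_deriv_smoothPrimitive_div (hf : IsSlowlyVarying f)
    (hint : ∀ a b, IntervalIntegrable (fun s => f s / s) volume a b) :
    Tendsto (fun t => logIncrement f t / max t 1 / f t) atTop (nhds 0) := by
  have h := (hf.tendsto_logIncrement_div hint).mul tendsto_inv_atTop_zero
  rw [mul_zero] at h
  refine h.congr' ?_
  filter_upwards [eventually_ge_atTop 1] with t ht
  rw [max_eq_left ht, ← div_eq_mul_inv, div_right_comm]

end IsSlowlyVarying

/-! ### Uniqueness for the pantograph equation -/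

/-- Solutions of the pantograph equation are unique. -/
theorem IsPantographSolution.eqOn {a b q ξ : ℝ} {φ z w : ℝ → ℝ} (hq : q ∈ Ioo (0 : ℝ) 1)
    (hw : IsPantographSolution a b q φ ξ w) (hz : IsPantographSolution a b q φ ξ z) :
    EqOn w z (Ici 0) := by
  intro T hT
  have hT : 0 ≤ T := hT
  set v : ℝ → ℝ := fun t => w t - z t with hv
  set K : ℝ := |a| + |b| + 1 with hK
  have hK0 : 0 < K := by positivity
  have hvd : ∀ t, 0 ≤ t → HasDerivWithinAt v (a * v (q * t) + b * v t) (Ici 0) t := by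
    intro t ht
    refine ((hw.deriv t ht).sub (hz.deriv t ht)).congr_deriv ?_
    simp only [hv]
    ring
  have hvc : ContinuousOn v (Icc 0 T) := fun t ht =>
    (hvd t ht.1).continuousWithinAt.mono Icc_subset_Ici_self
  have hmc : ContinuousOn (fun t => |v t| * Real.exp (-(K * t))) (Icc 0 T) :=
    hvc.abs.mul (by fun_prop)
  -- A contraction argument in the norm weighted by `exp (-(K t))`. Since `q t ≤ t`, the right-hand
  -- side is at most `(K - 1) m exp (K t)`. Integration gives `|v| ≤ (K - 1)/K · m exp (K t)`, which
  -- at the maximum point `x` forces `m ≤ 0`.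
  obtain ⟨x, hx, hmax⟩ := isCompact_Icc.exists_isMaxOn (nonempty_Icc.2 hT) hmc
  set m := |v x| * Real.exp (-(K * x)) with hm
  have hm0 : 0 ≤ m := by positivity
  have hle : ∀ t ∈ Icc 0 T, |v t| ≤ m * Real.exp (K * t) := by
    intro t ht
    have h := hmax ht
    change |v t| * Real.exp (-(K * t)) ≤ m at h
    rwa [Real.exp_neg, ← div_eq_mul_inv, div_le_iff₀ (Real.exp_pos _)] at h
  have hB : ∀ t, HasDerivAt (fun t => (K - 1) / K * m * Real.exp (K * t))
      ((K - 1) * m * Real.exp (K * t)) t := by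
    intro t
    have h := (((hasDerivAt_id t).const_mul K).exp).const_mul ((K - 1) / K * m)
    refine h.congr_deriv ?_
    simp only [id, mul_one]
    field_simp
  have hbound := image_norm_le_of_norm_deriv_right_le_deriv_boundary (f := v)
    (f' := fun t => a * v (q * t) + b * v t) (a := 0) (b := T) hvc
    (fun t ht => (hvd t ht.1).mono (Ici_subset_Ici.2 ht.1))
    (B := fun t => (K - 1) / K * m * Real.exp (K * t)) ?_ hB ?_
  · have h := hbound hx
    have hvx : |v x| = m * Real.exp (K * x) := by
      rw [hm, mul_assoc, ← Real.exp_add]; simp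
    rw [Real.norm_eq_abs, hvx] at h
    have h2 : m ≤ (K - 1) / K * m := le_of_mul_le_mul_right h (Real.exp_pos _)
    have h3 : (K - 1) / K * m = m - m / K := by field_simp
    have h4 : m / K ≤ 0 := by linarith
    have h5 : m ≤ 0 := by
      by_contra hc
      exact absurd h4 (not_le.2 (div_pos (not_le.1 hc) hK0))
    have h6 := hle T ⟨hT, le_rfl⟩
    have h7 : |v T| ≤ 0 := h6.trans (mul_nonpos_of_nonpos_of_nonneg h5 (Real.exp_pos _).le)
    exact sub_eq_zero.1 (abs_nonpos_iff.1 h7)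
  · have hK1 : 0 ≤ K - 1 := by rw [hK]; simp; positivity
    have : v 0 = 0 := by simp [hv, hw.init, hz.init]
    rw [this, norm_zero]
    positivity
  · intro t ht
    have hqt : q * t ∈ Icc 0 T :=
      ⟨mul_nonneg hq.1.le ht.1, (mul_le_of_le_one_left ht.1 hq.2.le).trans ht.2.le⟩
    have h1 := hle _ hqt
    have h2 := hle t ⟨ht.1, ht.2.le⟩
    have h3 : Real.exp (K * (q * t)) ≤ Real.exp (K * t) :=
      Real.exp_le_exp.2 (mul_le_mul_of_nonneg_left (mul_le_of_le_one_left ht.1 hq.2.le) hK0.le)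
    have h4 : |v (q * t)| ≤ m * Real.exp (K * t) := h1.trans (mul_le_mul_of_nonneg_left h3 hm0)
    calc ‖a * v (q * t) + b * v t‖ ≤ |a| * |v (q * t)| + |b| * |v t| := by
          rw [Real.norm_eq_abs]
          refine (abs_add_le _ _).trans ?_
          rw [abs_mul, abs_mul]
      _ ≤ |a| * (m * Real.exp (K * t)) + |b| * (m * Real.exp (K * t)) := by gcongr
      _ = (K - 1) * m * Real.exp (K * t) := by rw [hK]; ring

/-! ### The characteristic exponent and the slowly varying part of `γ` -/

/-- It makes `a (qt)^κ + b t^κ` vanish, so that only the difference `F(t) - F(qt)` survives in the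
forcing. -/
theorem rpow_pantographExponent {a b q : ℝ} (ha : 0 < a) (hb : b < 0) (hq : q ∈ Ioo (0 : ℝ) 1) :
    a * q ^ pantographExponent a b q = -b := by
  have hlog : Real.log q ≠ 0 := (Real.log_neg hq.1 hq.2).ne
  have hba : |b / a| = -b / a := by rw [abs_div, abs_of_neg hb, abs_of_pos ha]
  have hpos : 0 < -b / a := div_pos (neg_pos.2 hb) ha
  have h : Real.log q * pantographExponent a b q = Real.log (-b / a) := by
    rw [pantographExponent, hba, one_div, Real.log_inv]
    field_simp
  rw [Real.rpow_def_of_pos hq.1, h, Real.exp_log hpos, mul_div_cancel₀ _ ha.ne']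

/-- The slowly varying part `γ(t) / t^κ` on `[1,∞)` of a regularly varying function. -/
noncomputable def slowPart (κ : ℝ) (γ : ℝ → ℝ) : ℝ → ℝ :=
  indicator (Ici 1) fun t => γ t / t ^ κ

theorem slowPart_of_one_le {κ : ℝ} {γ : ℝ → ℝ} {t : ℝ} (ht : 1 ≤ t) :
    slowPart κ γ t = γ t / t ^ κ :=
  indicator_of_mem (mem_Ici.2 ht) _

theorem slowPart_div_of_one_le {κ : ℝ} {γ : ℝ → ℝ} {t : ℝ} (ht : 1 ≤ t) :
    slowPart κ γ t / t = γ t / t ^ (κ + 1) := by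
  rw [slowPart_of_one_le ht, Real.rpow_add_one (by linarith), div_div]

theorem IsRegularlyVarying.isSlowlyVarying_slowPart {κ : ℝ} {γ : ℝ → ℝ}
    (hγ : IsRegularlyVarying γ κ) : IsSlowlyVarying (slowPart κ γ) where
  aemeasurable := by
    have h1 : AEMeasurable γ (volume.restrict (Ici 1)) :=
      hγ.aemeasurable.mono_measure (Measure.restrict_mono (Ici_subset_Ici.2 zero_le_one) le_rfl)
    have h2 : AEMeasurable (fun t => γ t / t ^ κ) (volume.restrict (Ici 1)) :=
      h1.div (by fun_prop)
    exact h2.indicator measurableSet_Ici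
  pos t ht := by
    rw [slowPart_of_one_le ht]
    exact div_pos (hγ.pos t (by linarith)) (Real.rpow_pos_of_pos (by linarith) _)
  tendsto_ratio l hl := by
    have hlκ : 0 < l ^ κ := Real.rpow_pos_of_pos hl _
    have h := (hγ.tendsto_ratio l hl).div_const (l ^ κ)
    rw [div_self hlκ.ne'] at h
    refine h.congr' ?_
    filter_upwards [eventually_ge_atTop 1, eventually_ge_atTop (1 / l)] with t ht htl
    rw [div_le_iff₀' hl] at htl
    have ht0 : 0 < t := by linarith
    have h1 := hγ.pos t ht0.le
    have h2 : 0 < t ^ κ := Real.rpow_pos_of_pos ht0 _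
    rw [slowPart_of_one_le ht, slowPart_of_one_le htl, Real.mul_rpow hl.le ht0.le]
    field_simp

/-- The cutoff in `slowPart` makes the integrand vanish left of `1`, so integrability extends from
`[1, t]` to all bounded intervals. -/
theorem intervalIntegrable_slowPart_div {κ : ℝ} {γ : ℝ → ℝ}
    (h : ∀ t : ℝ, 1 ≤ t → IntervalIntegrable (fun s => γ s / s ^ (κ + 1)) volume 1 t) (a b : ℝ) :
    IntervalIntegrable (fun s => slowPart κ γ s / s) volume a b := by
  have key : ∀ b, IntervalIntegrable (fun s => slowPart κ γ s / s) volume 1 b := by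
    intro b
    rcases le_total 1 b with hb | hb
    · refine (h b hb).congr fun s hs => ?_
      rw [uIoc_of_le hb] at hs
      exact (slowPart_div_of_one_le hs.1.le).symm
    · refine IntervalIntegrable.symm ?_
      rw [intervalIntegrable_iff_integrableOn_Ioo_of_le hb]
      refine integrableOn_zero.congr_fun (fun s hs => ?_) measurableSet_Ioo
      simp [slowPart, hs.2]
  exact (key a).symm.trans (key b)

theorem growthBound_eq {κ : ℝ} {γ : ℝ → ℝ} {t : ℝ} (ht : 1 ≤ t) :
    growthBound κ γ t = t ^ κ * logPrimitive (slowPart κ γ) t := by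
  unfold growthBound logPrimitive
  congr 1
  refine intervalIntegral.integral_congr fun s hs => ?_
  rw [uIcc_of_le ht] at hs
  exact (slowPart_div_of_one_le hs.1).symm

/-! ### The prescribed solution and its forcing term -/

/-- A function with `z 0 = ξ` that equals `D t^κ F(t)` for `t ≥ 2`. -/
noncomputable def gluedSolution (ξ D κ : ℝ) (F : ℝ → ℝ) (t : ℝ) : ℝ :=
  -- The transition is `0` for `t ≤ 1` and `1` for `t ≥ 2`: the initial value is free, and a
  -- possible singularity of `t^κ` at `0` is never met.
  (1 - Real.smoothTransition (t - 1)) * ξ + Real.smoothTransition (t - 1) * (D * (t ^ κ * F t))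

theorem gluedSolution_zero (ξ D κ : ℝ) (F : ℝ → ℝ) : gluedSolution ξ D κ F 0 = ξ := by
  simp [gluedSolution, Real.smoothTransition.zero_of_nonpos]

theorem gluedSolution_of_two_le {ξ D κ : ℝ} {F : ℝ → ℝ} {t : ℝ} (ht : 2 ≤ t) :
    gluedSolution ξ D κ F t = D * (t ^ κ * F t) := by
  simp [gluedSolution, Real.smoothTransition.one_of_one_le (by linarith : 1 ≤ t - 1)]

theorem contDiff_gluedSolution (ξ D κ : ℝ) {F : ℝ → ℝ} (hF : ContDiff ℝ 1 F) :
    ContDiff ℝ 1 (gluedSolution ξ D κ F) := by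
  rw [contDiff_iff_contDiffAt]
  intro t
  have hχ : ContDiff ℝ 1 fun t : ℝ => Real.smoothTransition (t - 1) :=
    Real.smoothTransition.contDiff.comp (contDiff_id.sub contDiff_const)
  rcases lt_or_ge t 1 with ht | ht
  · refine (contDiffAt_const (c := ξ)).congr_of_eventuallyEq ?_
    filter_upwards [gt_mem_nhds ht] with s hs
    simp [gluedSolution, Real.smoothTransition.zero_of_nonpos (by linarith : s - 1 ≤ 0)]
  · have hpow : ContDiffAt ℝ 1 (fun t : ℝ => t ^ κ) t :=
      Real.contDiffAt_rpow_const_of_ne (by linarith)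
    exact ((contDiffAt_const.sub hχ.contDiffAt).mul contDiffAt_const).add
      (hχ.contDiffAt.mul (contDiffAt_const.mul (hpow.mul hF.contDiffAt)))

theorem deriv_gluedSolution {ξ D κ : ℝ} {F : ℝ → ℝ} {F' t : ℝ} (ht : 2 < t)
    (hF : HasDerivAt F F' t) :
    deriv (gluedSolution ξ D κ F) t = D * (t ^ κ * (κ * (F t / t) + F')) := by
  have h0 : t ≠ 0 := by linarith
  have h : HasDerivAt (fun t => D * (t ^ κ * F t)) (D * (t ^ κ * (κ * (F t / t) + F'))) t := by
    refine (((Real.hasDerivAt_rpow_const (p := κ) (Or.inl h0)).mul hF).const_mul D).congr_deriv ?_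
    rw [Real.rpow_sub_one h0]
    field_simp
  refine (h.congr_of_eventuallyEq ?_).deriv
  filter_upwards [lt_mem_nhds ht] with s hs
  exact gluedSolution_of_two_le hs.le

/-- The forcing term for which `z` solves the pantograph equation. -/
noncomputable def forcingOf (a b q : ℝ) (z : ℝ → ℝ) (t : ℝ) : ℝ :=
  deriv z t - a * z (q * t) - b * z t

theorem continuous_forcingOf (a b q : ℝ) {z : ℝ → ℝ} (hz : ContDiff ℝ 1 z) :
    Continuous (forcingOf a b q z) := by
  have h1 := hz.continuous_deriv le_rfl
  have h2 := hz.continuous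
  unfold forcingOf
  fun_prop

theorem isUniquePantographSolution_forcingOf {a b q : ℝ} (hq : q ∈ Ioo (0 : ℝ) 1) {z : ℝ → ℝ}
    (hz : ContDiff ℝ 1 z) :
    IsUniquePantographSolution a b q (forcingOf a b q z) (z 0) z := by
  have h : IsPantographSolution a b q (forcingOf a b q z) (z 0) z := by
    refine ⟨rfl, fun t _ => ?_⟩
    refine ((hz.differentiable one_ne_zero t).hasDerivAt.hasDerivWithinAt).congr_deriv ?_
    rw [forcingOf]
    ring
  exact ⟨h, fun w hw => hw.eqOn hq h⟩

/-- The forcing term of `D t^κ F(t)` when `κ` solves the characteristic equation. -/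
theorem forcingOf_gluedSolution {a b q ξ D κ : ℝ} {F : ℝ → ℝ} {F' t : ℝ} (hq0 : 0 < q)
    (hκ : a * q ^ κ = -b) (ht : 2 < t) (hqt : 2 ≤ q * t) (hF : HasDerivAt F F' t) :
    forcingOf a b q (gluedSolution ξ D κ F) t =
      D * t ^ κ * (κ * (F t / t) + F' + -b * (F t - F (q * t))) := by
  rw [forcingOf, deriv_gluedSolution ht hF, gluedSolution_of_two_le ht.le,
    gluedSolution_of_two_le hqt, Real.mul_rpow hq0.le (by linarith)]
  linear_combination (-D * t ^ κ * F (q * t)) * hκ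

/-! ### Assembly of the three parts -/

/-- For every regularly varying `γ` there is a forcing term asymptotic to `C γ` such that the
solution is asymptotic to a multiple of `growthBound κ γ`. -/
theorem exists_forcing_isEquivalent_growthBound {a b q ξ κ : ℝ} (ha : 0 < a) (hb : b < 0)
    (hq : q ∈ Ioo (0 : ℝ) 1) (hκ : κ = pantographExponent a b q) {C : ℝ} (hC : 0 < C)
    {γ : ℝ → ℝ} (hγ : IsRegularlyVarying γ κ)
    (hint : ∀ t : ℝ, 1 ≤ t → IntervalIntegrable (fun s => γ s / s ^ (κ + 1)) volume 1 t) :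
    ∃ φ : ℝ → ℝ, ContinuousOn φ (Ici 0) ∧ IsEquivalent atTop φ (fun t => C * γ t) ∧
      ∃ z : ℝ → ℝ, IsUniquePantographSolution a b q φ ξ z ∧
        ∃ D : ℝ, 0 < D ∧ IsEquivalent atTop z (fun t => D * growthBound κ γ t) := by
  have hchar : a * q ^ κ = -b := hκ ▸ rpow_pantographExponent ha hb hq
  have hf := hγ.isSlowlyVarying_slowPart
  have hfi := intervalIntegrable_slowPart_div hint
  set f := slowPart κ γ with hfdef
  have hlog2 : 0 < Real.log 2 := Real.log_pos one_lt_two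
  have hlogq : 0 < Real.log (1 / q) := Real.log_pos (one_lt_one_div hq.1 hq.2)
  have hb' : 0 < -b := neg_pos.2 hb
  have hFd := hasDerivAt_smoothPrimitive hfi
  set F := smoothPrimitive f with hFdef
  have hF1 : ContDiff ℝ 1 F := by
    refine contDiff_one_iff_deriv.2 ⟨fun t => (hFd t).differentiableAt, ?_⟩
    rw [funext fun t => (hFd t).deriv]
    exact continuous_div_max (continuous_logIncrement hfi)
  -- Chosen so that the main term of the forcing, `D t^κ (-b) (log(1/q) log 2) f(t)`, equals `C
  -- γ(t)`.
  set D := C / (-b * (Real.log (1 / q) * Real.log 2)) with hD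
  have hD0 : 0 < D := by positivity
  set z := gluedSolution ξ D κ F with hz
  have hz1 : ContDiff ℝ 1 z := contDiff_gluedSolution ξ D κ hF1
  have hz0 : z 0 = ξ := gluedSolution_zero ξ D κ F
  -- The constant in the growth of `z` is `D log 2` because `F ~ L log 2`.
  refine ⟨forcingOf a b q z, (continuous_forcingOf a b q hz1).continuousOn, ?_, z,
    hz0 ▸ isUniquePantographSolution_forcingOf hq hz1, D * Real.log 2, by positivity, ?_⟩
  · have hne : ∀ᶠ t in atTop, C * γ t ≠ 0 := by
      filter_upwards [eventually_ge_atTop 0] with t ht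
      exact (mul_pos hC (hγ.pos t ht)).ne'
    rw [isEquivalent_iff_tendsto_one hne]
    have h1 := (((hf.tendsto_smoothPrimitive_div_mul hfi).const_mul κ).add
      (hf.tendsto_deriv_smoothPrimitive_div hfi)).add
      ((hf.tendsto_smoothPrimitive_sub_div hfi hq.1 hq.2).const_mul (-b))
    have h2 := h1.const_mul (D / C)
    have h3 : D / C * (κ * 0 + 0 + -b * (Real.log (1 / q) * Real.log 2)) = 1 := by
      rw [mul_zero, zero_add, zero_add, hD, div_div, mul_comm _ C, ← div_div, div_self hC.ne',
        one_div, inv_mul_cancel₀ (by positivity)]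
    rw [h3] at h2
    refine h2.congr' ?_
    filter_upwards [eventually_gt_atTop 2, eventually_ge_atTop (2 / q)] with t ht htq
    rw [div_le_iff₀' hq.1] at htq
    have ht0 : 0 < t := by linarith
    have h4 := hγ.pos t ht0.le
    have h5 : 0 < t ^ κ := Real.rpow_pos_of_pos ht0 _
    simp only [Pi.div_apply]
    rw [hz, forcingOf_gluedSolution hq.1 hchar ht htq (hFd t), hfdef,
      slowPart_of_one_le (by linarith : 1 ≤ t), ← hfdef, ← hFdef]
    generalize logIncrement f t / max t 1 = F'
    field_simp
  · have hgb : ∀ t : ℝ, 1 < t → 0 < growthBound κ γ t := fun t ht => by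
      rw [growthBound_eq ht.le]
      exact mul_pos (Real.rpow_pos_of_pos (by linarith) _) (hf.logPrimitive_pos hfi ht)
    have hne : ∀ᶠ t in atTop, D * Real.log 2 * growthBound κ γ t ≠ 0 := by
      filter_upwards [eventually_gt_atTop 1] with t ht
      exact (mul_pos (by positivity) (hgb t ht)).ne'
    rw [isEquivalent_iff_tendsto_one hne]
    have h1 := (hf.tendsto_smoothPrimitive_div_logPrimitive hfi).div_const (Real.log 2)
    rw [div_self hlog2.ne'] at h1
    refine h1.congr' ?_
    filter_upwards [eventually_ge_atTop 2] with t ht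
    have h2 := hf.logPrimitive_pos hfi (by linarith : 1 < t)
    have h3 : 0 < t ^ κ := Real.rpow_pos_of_pos (by linarith) _
    simp only [Pi.div_apply]
    rw [hz, gluedSolution_of_two_le ht, growthBound_eq (by linarith : 1 ≤ t), ← hfdef, ← hFdef]
    field_simp

/-- The constant is `I = ∫_1^∞ γ(s)/s^(κ+1) ds`, finite by integrability and positive because `γ`
is. It reduces (b) to the general construction. -/
theorem exists_growthBound_isEquivalent_rpow {κ : ℝ} {γ : ℝ → ℝ} (hγ : IsRegularlyVarying γ κ)
    (hint : IntegrableOn (fun t => γ t / t ^ (κ + 1)) (Ioi 0) volume) :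
    ∃ I : ℝ, 0 < I ∧ IsEquivalent atTop (growthBound κ γ) (fun t => I * t ^ κ) := by
  have hint1 := hint.mono_set (Ioi_subset_Ioi zero_le_one)
  have hlim := intervalIntegral_tendsto_integral_Ioi 1 hint1 tendsto_id
  set I := ∫ s in Ioi (1 : ℝ), γ s / s ^ (κ + 1) with hI
  have hI0 : 0 < I := by
    have hpos : ∀ s ∈ Ioi (1 : ℝ), 0 < γ s / s ^ (κ + 1) := fun s hs => by
      have hs0 : 0 < s := one_pos.trans hs
      exact div_pos (hγ.pos s hs0.le) (Real.rpow_pos_of_pos hs0 _)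
    rw [hI, setIntegral_pos_iff_support_of_nonneg_ae
      (ae_restrict_of_forall_mem measurableSet_Ioi fun s hs => (hpos s hs).le) hint1,
      inter_eq_right.2 (show Ioi (1 : ℝ) ⊆ Function.support _ from fun s hs => (hpos s hs).ne')]
    simp
  refine ⟨I, hI0, ?_⟩
  have hne : ∀ᶠ t : ℝ in atTop, I * t ^ κ ≠ 0 := by
    filter_upwards [eventually_gt_atTop 0] with t ht
    exact (mul_pos hI0 (Real.rpow_pos_of_pos ht _)).ne'
  rw [isEquivalent_iff_tendsto_one hne]
  have h := hlim.div_const I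
  rw [div_self hI0.ne'] at h
  refine h.congr' ?_
  filter_upwards [eventually_gt_atTop 0] with t ht
  have h3 : 0 < t ^ κ := Real.rpow_pos_of_pos ht _
  simp only [Pi.div_apply, growthBound, id]
  field_simp

theorem mainTheorem8 (a b q ξ κ : ℝ) (ha : 0 < a) (hb : b < 0) (hq : q ∈ Ioo (0 : ℝ) 1)
    (hκ : κ = pantographExponent a b q) :
    -- (a) large perturbations
    (∀ C : ℝ, 0 < C → ∀ γ : ℝ → ℝ, IsRegularlyVarying γ κ →
      (∀ t : ℝ, 1 ≤ t → IntervalIntegrable (fun s => γ s / s ^ (κ + 1)) volume 1 t) →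
      ¬ IntegrableOn (fun t => γ t / t ^ (κ + 1)) (Ioi 0) volume →
      ∃ φ : ℝ → ℝ, ContinuousOn φ (Ici 0) ∧ IsEquivalent atTop φ (fun t => C * γ t) ∧
        ∃ z : ℝ → ℝ, IsUniquePantographSolution a b q φ ξ z ∧
          ∃ D : ℝ, 0 < D ∧ IsEquivalent atTop z (fun t => D * growthBound κ γ t)) ∧
    -- (b) small perturbations
    (∀ C : ℝ, 0 < C → ∀ γ : ℝ → ℝ, IsRegularlyVarying γ κ →
      IntegrableOn (fun t => γ t / t ^ (κ + 1)) (Ioi 0) volume →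
      ∃ φ : ℝ → ℝ, ContinuousOn φ (Ici 0) ∧ IsEquivalent atTop φ (fun t => C * γ t) ∧
        ∃ z : ℝ → ℝ, IsUniquePantographSolution a b q φ ξ z ∧
          ∃ D : ℝ, 0 < D ∧ IsEquivalent atTop z (fun t => D * t ^ κ)) ∧
    -- (c) in both cases the order of the bound is attained
    (∀ C : ℝ, 0 < C → ∀ γ : ℝ → ℝ, IsRegularlyVarying γ κ →
      (∀ t : ℝ, 1 ≤ t → IntervalIntegrable (fun s => γ s / s ^ (κ + 1)) volume 1 t) →
      ∃ φ : ℝ → ℝ, ContinuousOn φ (Ici 0) ∧ IsEquivalent atTop φ (fun t => C * γ t) ∧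
        ∃ z : ℝ → ℝ, IsUniquePantographSolution a b q φ ξ z ∧
          IsTheta atTop z (growthBound κ γ)) := by
  refine ⟨fun C hC γ hγ hint _ => ?_, fun C hC γ hγ hint => ?_, fun C hC γ hγ hint => ?_⟩
  · exact exists_forcing_isEquivalent_growthBound ha hb hq hκ hC hγ hint
  · have hint1 : ∀ t : ℝ, 1 ≤ t → IntervalIntegrable (fun s => γ s / s ^ (κ + 1)) volume 1 t :=
      fun t ht => (intervalIntegrable_iff_integrableOn_Ioc_of_le ht).2
        (hint.mono_set fun s hs => one_pos.trans hs.1)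
    obtain ⟨φ, hφ, hφγ, z, hz, D, hD, hzD⟩ :=
      exists_forcing_isEquivalent_growthBound (ξ := ξ) ha hb hq hκ hC hγ hint1
    obtain ⟨I, hI, hgI⟩ := exists_growthBound_isEquivalent_rpow hγ hint
    refine ⟨φ, hφ, hφγ, z, hz, D * I, mul_pos hD hI, ?_⟩
    have h := hzD.trans ((IsEquivalent.refl (u := fun _ : ℝ => D)).mul hgI)
    simpa only [Pi.mul_def, mul_assoc] using h
  · obtain ⟨φ, hφ, hφγ, z, hz, D, hD, hzD⟩ :=
      exists_forcing_isEquivalent_growthBound (ξ := ξ) ha hb hq hκ hC hγ hint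
    exact ⟨φ, hφ, hφγ, z, hz, hzD.isTheta.trans (isTheta_rfl.const_mul_left hD.ne')⟩
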